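/- Let $R$ be a finite local commutative ring with identity that is not a field, let $\mathrm{rad}(R)$ be its maximal ideal, and let $q$ be the order of the residue field $R/\mathrm{rad}(R)$. Put $I_0=\{x\in \mathrm{rad}(R): x\,\mathrm{rad}(R)=\{0\}\}$, $\mathcal U_0=1+I_0$, and let $\mathcal T=\{u\in R^\times: u^{q-1}=1\}$ be the Teichmüller group of $R$ (the unique subgroup of $R^\times$ of order $q-1$). For a subgroup $K\le R^\times$, let $\mathrm{Cyc}(K,R)$ be the cyclotomic scheme on $R$ whose basis relations are the sets $\{(x,y)\in R\times R: y-x\in rK\}$, $r\in R$. Its automorphism group consists of all permutations of $R$ that map each basis relation onto itself. The scheme is called normal if this group is contained in $\mathrm{A\Gamma L}_1(R)$, the group of all permutations $x\mapsto a\,\sigma(x)+b$ with $a\in R^\times$, $b\in R$, $\sigma\in\mathrm{Aut}(R)$. The group $K$ is called pure if the only ideal $I$ of $R$ with $K+I=K$ is $I=\{0\}$. 1. If $K\le R^\times$ is pure and $K\le \mathcal T\,\mathcal U_0$, then $\mathrm{Cyc}(K,R)$ is normal. 2. In particular, if $\mathrm{rad}(R)^2=\{0\}$, then $\mathrm{Cyc}(K,R)$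 is normal for every pure $K\le R^\times$. -/

import Mathlib

open scoped Pointwise

namespace CycScheme

/-- A scheme (coherent configuration) on `V`: a partition of `V × V` into nonempty basis relations
which is closed under transposition, for which the diagonal is a union of basis relations, and
which has well-defined intersection numbers. -/
structure Scheme (V : Type*) where
  /-- the set of basis relations -/
  basisRel : Set (Set (V × V))
  isPartition : Setoid.IsPartition basisRel
  transpose_mem : ∀ S ∈ basisRel, Prod.swap ⁻¹' S ∈ basisRel
  diagonal_eq : ∃ D : Set (Set (V × V)), D ⊆ basisRel ∧ ⋃₀ D = Set.diagonal V
  intersection_number : ∀ S ∈ basisRel, ∀ T ∈ basisRel, ∀ Q ∈ basisRel, ∀ p ∈ Q, ∀ p' ∈ Q,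
    {v : V | (p.1, v) ∈ S ∧ (v, p.2) ∈ T}.ncard = {v : V | (p'.1, v) ∈ S ∧ (v, p'.2) ∈ T}.ncard

/-- The automorphism group of a scheme: the permutations of the point set that map every basis
relation onto itself. -/
def Scheme.aut {V : Type*} (C : Scheme V) : Subgroup (Equiv.Perm V) where
  carrier := {f | ∀ S ∈ C.basisRel, Prod.map f f '' S = S}
  one_mem' := by
    intro S _
    simp
  mul_mem' := by
    intro f g hf hg S hS
    have h : (Prod.map (f * g) (f * g) : V × V → V × V) = Prod.map f f ∘ Prod.map g g := by
      ext p <;> rfl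
    rw [h, Set.image_comp, hg S hS, hf S hS]
  inv_mem' := by
    intro f hf S hS
    have h : (Prod.map (f⁻¹ : Equiv.Perm V) (f⁻¹ : Equiv.Perm V) : V × V → V × V) ∘ Prod.map f f
        = id := by
      ext p <;> simp
    conv_lhs => rw [← hf S hS]
    rw [← Set.image_comp, h, Set.image_id]

variable {R : Type*} [CommRing R]

/-- The binary relation `{(x, y) : y - x ∈ rK}` on `R`. -/
def cycRel (K : Subgroup Rˣ) (r : R) : Set (R × R) :=
  {p | ∃ k ∈ K, p.2 - p.1 = r * (k : R)}

theorem cycRel_eq_of_mem {K : Subgroup Rˣ} {r : R} {p : R × R} (hp : p ∈ cycRel K r) :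
    cycRel K (p.2 - p.1) = cycRel K r := by
  obtain ⟨k, hk, e⟩ := hp
  ext q
  constructor
  · rintro ⟨l, hl, h⟩
    exact ⟨k * l, K.mul_mem hk hl, by rw [h, e]; push_cast; ring⟩
  · rintro ⟨l, hl, h⟩
    refine ⟨k⁻¹ * l, K.mul_mem (K.inv_mem hk) hl, ?_⟩
    rw [h, e]
    push_cast
    rw [mul_assoc, Units.mul_inv_cancel_left]

/-- The cyclotomic scheme `Cyc(K, R)`, with basis relations `{(x, y) : y - x ∈ rK}`, `r ∈ R`. -/
def cyc (K : Subgroup Rˣ) : Scheme R where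
  basisRel := Set.range (cycRel K)
  isPartition := by
    have self (r : R) : ((0 : R), r) ∈ cycRel K r := ⟨1, K.one_mem, by simp⟩
    refine ⟨?_, ?_⟩
    · rintro ⟨r, hr⟩
      have := self r
      rw [hr] at this
      exact this
    · intro p
      refine ⟨cycRel K (p.2 - p.1), ⟨⟨_, rfl⟩, ⟨1, K.one_mem, by simp⟩⟩, ?_⟩
      rintro _ ⟨⟨r, rfl⟩, hp⟩
      exact (cycRel_eq_of_mem hp).symm
  transpose_mem := by
    rintro _ ⟨r, rfl⟩
    refine ⟨-r, ?_⟩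
    ext ⟨x, y⟩
    simp only [cycRel, Set.mem_preimage, Set.mem_ofPred_eq, Prod.swap_prod_mk]
    refine exists_congr fun k => and_congr_right fun _ => ?_
    constructor <;> intro h
    · linear_combination -h
    · linear_combination -h
  diagonal_eq := by
    refine ⟨{cycRel K 0}, by simp, ?_⟩
    ext ⟨x, y⟩
    simp only [Set.sUnion_singleton, cycRel, Set.mem_ofPred_eq, zero_mul, Set.mem_diagonal_iff]
    constructor
    · rintro ⟨_, _, h⟩
      exact (sub_eq_zero.mp h).symm
    · intro h
      exact ⟨1, K.one_mem, sub_eq_zero.mpr h.symm⟩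
  intersection_number := by
    rintro _ ⟨s, rfl⟩ _ ⟨t, rfl⟩ _ ⟨r, rfl⟩ p ⟨k, hk, hp⟩ p' ⟨l, hl, hp'⟩
    -- the affine bijection carrying `p` to `p'`
    have hkk : (k : R) * ((k⁻¹ : Rˣ) : R) = 1 := Units.mul_inv k
    refine Set.ncard_congr (fun v _ => ((k⁻¹ * l : Rˣ) : R) * (v - p.1) + p'.1) ?_ ?_ ?_
    · rintro v ⟨⟨a, ha, h1⟩, b, hb, h2⟩
      refine ⟨⟨k⁻¹ * l * a, K.mul_mem (K.mul_mem (K.inv_mem hk) hl) ha, ?_⟩,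
        ⟨k⁻¹ * l * b, K.mul_mem (K.mul_mem (K.inv_mem hk) hl) hb, ?_⟩⟩
      · push_cast at h1 ⊢
        linear_combination (((k⁻¹ : Rˣ) : R) * l) * h1
      · push_cast at h2 ⊢
        linear_combination (((k⁻¹ : Rˣ) : R) * l) * h2 + hp' -
          (((k⁻¹ : Rˣ) : R) * l) * hp - r * l * hkk
    · intro v w _ _ h
      have h' := (Units.mul_right_inj (k⁻¹ * l)).mp (add_right_cancel h)
      exact sub_left_injective h'
    · rintro w ⟨⟨a, ha, h1⟩, b, hb, h2⟩
      have hll : (l : R) * ((l⁻¹ : Rˣ) : R) = 1 := Units.mul_inv l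
      refine ⟨((l⁻¹ * k : Rˣ) : R) * (w - p'.1) + p.1,
        ⟨⟨l⁻¹ * k * a, K.mul_mem (K.mul_mem (K.inv_mem hl) hk) ha, ?_⟩,
        ⟨l⁻¹ * k * b, K.mul_mem (K.mul_mem (K.inv_mem hl) hk) hb, ?_⟩⟩, ?_⟩
      · push_cast at h1 ⊢
        linear_combination (((l⁻¹ : Rˣ) : R) * k) * h1
      · push_cast at h2 ⊢
        linear_combination (((l⁻¹ : Rˣ) : R) * k) * h2 + hp -
          (((l⁻¹ : Rˣ) : R) * k) * hp' - r * k * hll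
      · push_cast
        linear_combination (w - p'.1) * (l * ((l⁻¹ : Rˣ) : R) * hkk + hll)

variable (R) in
/-- The group `AΓL₁(R)` of all permutations `x ↦ a σ(x) + b` of `R`, where `a` is a unit, `σ` is a
ring automorphism and `b ∈ R`. -/
def AGammaL : Subgroup (Equiv.Perm R) where
  carrier := {f | ∃ (a : Rˣ) (σ : R ≃+* R) (b : R), ∀ x, f x = a * σ x + b}
  one_mem' := ⟨1, RingEquiv.refl R, 0, by simp⟩
  mul_mem' := by
    rintro f g ⟨a, σ, b, hf⟩ ⟨c, τ, d, hg⟩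
    refine ⟨a * Units.map (σ : R →* R) c, τ.trans σ, a * σ d + b, fun x => ?_⟩
    rw [Equiv.Perm.mul_apply, hg, hf]
    simp
    ring
  inv_mem' := by
    rintro f ⟨a, σ, b, hf⟩
    refine ⟨Units.map (σ.symm : R →* R) a⁻¹, σ.symm,
      -σ.symm (((a⁻¹ : Rˣ) : R) * b), fun x => ?_⟩
    rw [Equiv.Perm.inv_eq_iff_eq, hf]
    simp [mul_add, ← mul_assoc]

/-- A scheme on the ring `R` is normal if its automorphism group is contained in `AΓL₁(R)`. -/
def Scheme.IsNormal (C : Scheme R) : Prop := C.aut ≤ AGammaL R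

/-- A group `K ≤ Rˣ` is pure if `{0}` is the only ideal `I` of `R` with `K + I = K`
(sums of subsets of `R`). -/
def IsPure (K : Subgroup Rˣ) : Prop :=
  ∀ I : Ideal R, ((↑) '' (K : Set Rˣ) : Set R) + (I : Set R) = (↑) '' (K : Set Rˣ) → I = ⊥

/-- The group `Rˣ ∩ (1 + I)` for an ideal `I`; this is `1 + I` if `I` lies in the radical. -/
def oneAdd (I : Ideal R) : Subgroup Rˣ where
  carrier := {u | (u : R) - 1 ∈ I}
  one_mem' := by simp
  mul_mem' := by
    intro u v hu hv
    have h : ((u * v : Rˣ) : R) - 1 = v * ((u : R) - 1) + ((v : R) - 1) := by push_cast; ring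
    rw [Set.mem_ofPred_eq, h]
    exact I.add_mem (I.mul_mem_left _ hu) hv
  inv_mem' := by
    intro u hu
    have h : ((u⁻¹ : Rˣ) : R) - 1 = -((u⁻¹ : Rˣ) : R) * ((u : R) - 1) := by
      linear_combination Units.inv_mul u
    rw [Set.mem_ofPred_eq, h]
    exact I.mul_mem_left _ hu

variable (R) in
/-- The ideal `I₀ = {x ∈ rad(R) : x rad(R) = {0}}` of a local ring `R`. -/
def idealI₀ [IsLocalRing R] : Ideal R :=
  IsLocalRing.maximalIdeal R ⊓ (IsLocalRing.maximalIdeal R).annihilator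

variable (R) in
/-- The Teichmüller group of a finite local ring with residue field of order `q`: the group of all
units `u` with `u ^ (q - 1) = 1`. It is the unique subgroup of `Rˣ` of order `q - 1`, because `Rˣ` is
the direct product of a cyclic group of order `q - 1` and the `p`-group `1 + rad(R)`. -/
noncomputable def teichmuller [IsLocalRing R] : Subgroup Rˣ :=
  (powMonoidHom (Nat.card (IsLocalRing.ResidueField R) - 1) : Rˣ →* Rˣ).ker

end CycScheme

/-! Let `k` be the residue field. The ideal I₀ is a `k`-vector space, and the elements of `K` are
t(1 + v) with t Teichmüller and v in an additive group V ⊆ I₀. Purity says exactly what is needed of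
V: it contains no nonzero `k`-line (`IsPure.eq_zero`). An automorphism, normalized to g(0) = 0 and
g(1) = 1, multiplies each difference by such a t(1 + v). The engine is `eq_add_smul_of_slope_mem`: a
function from `k` to a vector space whose slopes all lie in a subgroup without lines is affine. It
is applied to the defects of g, which then vanish because they vanish at 0 and 1. If rad(R) is not
contained in I₀, an element b of rad(R) outside I₀ forces all relevant Teichmüller factors to be 1;
the displacement g(x) - x is then affine over `k`, and g is the identity (`eq_self_of_lt`). If
rad(R) = I₀, comparing differences modulo V links the map induced on `k` with the action on cosets
of I₀. A Hua-type argument makes the induced map a field automorphism σ (`exists_residueEquiv`), and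
the additive and multiplicative defects of g have σ-twisted slopes in V, so g is a ring automorphism
(`map_add_map_mul`). -/

theorem exists_addMonoidHom_zmod_ne_zero {W : Type*} [AddCommGroup W] {p : ℕ} [Fact p.Prime]
    (hW : ∀ w : W, p • w = 0) {w : W} (hw : w ≠ 0) : ∃ f : W →+ ZMod p, f w ≠ 0 := by
  have key [Module (ZMod p) W] : ∃ f : W →ₗ[ZMod p] ZMod p, f w ≠ 0 :=
    Module.Projective.exists_dual_ne_zero (ZMod p) hw
  obtain ⟨f, hf⟩ := @key (AddCommGroup.zmodModule hW)
  exact ⟨f.toAddMonoidHom, hf⟩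

/-! ### Functions on a finite field with restricted slopes -/

section FiniteField

variable {k : Type*} [Field k] [Finite k]

theorem exists_unit_pow_ne_one {d : ℕ} (hd : 0 < d) (hd' : d < Nat.card k - 1) :
    ∃ z : kˣ, z ^ d ≠ 1 := by
  obtain ⟨g, hg⟩ := IsCyclic.exists_generator (α := kˣ)
  refine ⟨g, fun h => ?_⟩
  have h1 : orderOf g = Nat.card kˣ := orderOf_eq_card_of_forall_mem_zpowers hg
  have h2 := Nat.le_of_dvd hd (orderOf_dvd_of_pow_eq_one h)
  rw [h1, Nat.card_units] at h2
  omega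

/-- A counting argument with q = |k|. If A ≠ 0, at least q/2 elements lie outside ker A, and w ↦ 1 +
w⁻¹ injects them into the d-torsion of `kˣ`, a proper subgroup with at most (q - 1)/2 elements. -/
theorem AddMonoidHom.eq_zero_of_mul_pow_eq {A : k →+ k} {d : ℕ} (hd : 0 < d)
    (hd' : d < Nat.card k - 1) (h1 : A 1 = 0)
    (h : ∀ w : k, w ≠ 0 → 1 + w⁻¹ ≠ 0 → (1 + w⁻¹) ^ d * A w = A w) : A = 0 := by
  by_contra hA
  have hH : A.ker ≠ ⊤ := fun h => hA (A.ker_eq_top_iff.mp h)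
  set S : Subgroup kˣ := (powMonoidHom d : kˣ →* kˣ).ker with hS
  have hS' : S ≠ ⊤ := by
    obtain ⟨z, hz⟩ := exists_unit_pow_ne_one hd hd'
    intro h
    have : z ∈ S := h ▸ Subgroup.mem_top z
    exact hz this
  have c1 : 2 * Nat.card A.ker ≤ Nat.card k := by
    rw [← A.ker.card_mul_index, mul_comm]
    have : A.ker.index ≠ 1 := fun h => hH (AddSubgroup.index_eq_one.mp h)
    have : A.ker.index ≠ 0 := AddSubgroup.index_ne_zero_of_finite
    exact Nat.mul_le_mul_left _ (by omega)
  have c2 : 2 * Nat.card S ≤ Nat.card k - 1 := by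
    rw [← Nat.card_units, ← S.card_mul_index, mul_comm]
    have : S.index ≠ 1 := fun h => hS' (Subgroup.index_eq_one.mp h)
    have : S.index ≠ 0 := Subgroup.index_ne_zero_of_finite
    exact Nat.mul_le_mul_left _ (by omega)
  have ne0 : ∀ w : k, w ∉ A.ker → w ≠ 0 := by
    rintro w hw rfl
    exact hw (zero_mem _)
  have ne1 : ∀ w : k, w ∉ A.ker → 1 + w⁻¹ ≠ 0 := by
    intro w hw h
    have hw0 := ne0 w hw
    have : w = -1 := by
      field_simp at h
      linear_combination h
    apply hw
    rw [this]
    exact neg_mem (by simpa [AddMonoidHom.mem_ker] using h1)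
  let φ : ((A.ker : Set k)ᶜ : Set k) → S := fun w =>
    ⟨Units.mk0 (1 + (w : k)⁻¹) (ne1 w w.2), by
      rw [hS, MonoidHom.mem_ker]
      ext
      have := h w (ne0 w w.2) (ne1 w w.2)
      have hw : A w ≠ 0 := w.2
      simpa [hw] using this⟩
  have hφ : Function.Injective φ := by
    intro w w' e
    have := congrArg (fun z : S => ((z : kˣ) : k)) e
    simpa [φ, Subtype.ext_iff] using this
  have c3 := Nat.card_le_card_of_injective φ hφ
  have c4 := Set.ncard_add_ncard_compl (A.ker : Set k)
  rw [← Nat.card_coe_set_eq, ← Nat.card_coe_set_eq] at c4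
  have c5 : 0 < Nat.card k := Nat.card_pos
  have c6 : Nat.card (A.ker : Set k) = Nat.card A.ker := rfl
  omega

/-- Fourier inversion on the cyclic group `kˣ`: only the trivial character contributes, and the
factor 1/(q - 1) equals -1 in `k`. -/
theorem eq_of_sum_inv_pow_mul_eq_zero [Fintype kˣ] (N : kˣ → k)
    (h : ∀ d, 0 < d → d < Nat.card k - 1 → ∑ c : kˣ, ((c⁻¹ : kˣ) : k) ^ d * N c = 0) (x y : kˣ) :
    N x = N y := by
  classical
  have hc : 1 < Nat.card k := Finite.one_lt_card
  have key : ∀ x : kˣ, N x = - ∑ c : kˣ, N c := by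
    intro x
    have e1 : ∑ d ∈ Finset.range (Nat.card k - 1),
        (x : k) ^ d * ∑ c : kˣ, ((c⁻¹ : kˣ) : k) ^ d * N c = ∑ c : kˣ, N c := by
      rw [Finset.sum_eq_single 0]
      · simp
      · intro d hd hd0
        rw [h d (Nat.pos_of_ne_zero hd0) (Finset.mem_range.mp hd), mul_zero]
      · intro h0
        simp at h0
        omega
    have e2 : ∑ d ∈ Finset.range (Nat.card k - 1),
        (x : k) ^ d * ∑ c : kˣ, ((c⁻¹ : kˣ) : k) ^ d * N c = - N x := by
      simp_rw [Finset.mul_sum]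
      rw [Finset.sum_comm, Finset.sum_eq_single x]
      · have h0 : (Nat.card k : k) = 0 := by
          have := Fintype.ofFinite k
          rw [Nat.card_eq_fintype_card, Nat.cast_card_eq_zero]
        simp [Nat.cast_sub hc.le, h0]
      · intro c _ hcx
        simp_rw [← mul_assoc, ← mul_pow]
        rw [← Finset.sum_mul]
        have hz : ((x * c⁻¹ : kˣ) : k) ≠ 1 := by
          intro h
          rw [Units.val_eq_one, mul_inv_eq_one] at h
          exact hcx h.symm
        have := geom_sum_eq hz (Nat.card k - 1)
        rw [Units.val_mul] at this
        rw [this, ← Units.val_mul, ← Units.val_pow_eq_pow_val, ← Nat.card_units, pow_card_eq_one']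
        simp
      · simp
    rw [← e1, e2, neg_neg]
  rw [key x, key y]

/-- The claim is that c ↦ L_c(c⁻¹w) is constant on `kˣ`. Its moments A_d, as functions of w, are
additive, and the slope symmetry makes the nontrivial ones vanish by
`AddMonoidHom.eq_zero_of_mul_pow_eq`. -/
theorem apply_eq_of_slope (L : k → k →+ k) (h0 : L 0 = 0)
    (h : ∀ x y, x ≠ y → L x (y - x)⁻¹ = L y (y - x)⁻¹) (x u : k) : L x u = L 1 (x * u) := by
  have := Fintype.ofFinite kˣ
  rcases eq_or_ne x 0 with rfl | hx
  · simp [h0]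
  let A (d : ℕ) : k →+ k := ∑ c : kˣ, (AddMonoidHom.mulLeft (((c⁻¹ : kˣ) : k) ^ d)).comp
    ((L c).comp (AddMonoidHom.mulLeft ((c⁻¹ : kˣ) : k)))
  have hA (d : ℕ) (w : k) :
      A d w = ∑ c : kˣ, ((c⁻¹ : kˣ) : k) ^ d * L c (((c⁻¹ : kˣ) : k) * w) := by
    simp [A, AddMonoidHom.finsetSum_apply]
  have hA1 (d : ℕ) : A d 1 = 0 := by
    rw [hA]
    refine Finset.sum_eq_zero fun c _ => ?_
    have := h 0 c c.ne_zero.symm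
    simp only [h0, sub_zero, AddMonoidHom.zero_apply] at this
    simp [← this]
  have hA0 : ∀ d, 0 < d → d < Nat.card k - 1 → A d = 0 := by
    intro d hd hd'
    refine AddMonoidHom.eq_zero_of_mul_pow_eq hd hd' (hA1 d) fun w hw hz => ?_
    have e1 : A d w = A d (1 + w) := by rw [map_add, hA1, zero_add]
    conv_lhs => rw [e1]
    rw [hA, hA, Finset.mul_sum]
    -- Substituting c' = c(1 + w⁻¹) gives c'⁻¹(1 + w) = c⁻¹w = (c' - c)⁻¹, which is where the slope
    -- symmetry applies to the pair c, c'.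
    refine (Fintype.sum_equiv (Equiv.mulRight (Units.mk0 _ hz)) _ _ fun c => ?_).symm
    have hc := c.ne_zero
    have hne : (c : k) ≠ c * (1 + w⁻¹) := by
      intro e
      have : (c : k) * w⁻¹ = 0 := by linear_combination -e
      simp [hw] at this
    have := h c (c * (1 + w⁻¹)) hne
    have e2 : ((c : k) * (1 + w⁻¹) - c)⁻¹ = (c : k)⁻¹ * w := by
      field_simp
      ring
    rw [e2] at this
    have e3 : (c * (1 + w⁻¹))⁻¹ * (1 + w) = (c : k)⁻¹ * w := by
      have : (1 + w⁻¹) * w = 1 + w := by field_simp; ring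
      rw [← this, mul_inv, mul_assoc, inv_mul_cancel_left₀ hz]
    simp only [Equiv.coe_mulRight, Units.val_inv_eq_inv_val, Units.val_mul, Units.val_mk0, e3,
      ← mul_assoc, ← this]
    rw [← mul_pow, mul_inv, mul_left_comm, mul_inv_cancel₀ hz, mul_one]
  have := eq_of_sum_inv_pow_mul_eq_zero (fun c : kˣ => L c (((c⁻¹ : kˣ) : k) * (x * u)))
    (fun d hd hd' => by rw [← hA, hA0 d hd hd', AddMonoidHom.zero_apply]) (Units.mk0 x hx) 1
  simpa [hx] using this

/-- If all slopes of a function on a finite field with values in a vector space lie in an additive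
subgroup that contains no line, then the function is affine. -/
theorem eq_add_smul_of_slope_mem {M : Type*} [AddCommGroup M] [Module k M] {V : AddSubgroup M}
    (hV : ∀ z : M, (∀ u : k, u • z ∈ V) → z = 0) (h : k → M)
    (hh : ∀ x y, ∃ v ∈ V, h y - h x = (y - x) • v) (x : k) :
    h x = h 0 + x • (h 1 - h 0) := by
  rw [← sub_eq_zero]
  refine hV _ fun u => ?_
  by_contra hu
  obtain ⟨p, hp⟩ := CharP.exists k
  have hpp : Fact p.Prime := ⟨CharP.char_is_prime k p⟩
  have hM : ∀ m : M ⧸ V, p • m = 0 := by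
    intro m
    obtain ⟨m, rfl⟩ := QuotientAddGroup.mk_surjective m
    rw [← QuotientAddGroup.mk_nsmul, ← Nat.cast_smul_eq_nsmul k, CharP.cast_eq_zero, zero_smul]
    rfl
  have hne : ((u • (h x - (h 0 + x • (h 1 - h 0))) : M) : M ⧸ V) ≠ 0 := by
    rwa [Ne, QuotientAddGroup.eq_zero_iff]
  obtain ⟨lam, hlam⟩ := exists_addMonoidHom_zmod_ne_zero hM hne
  -- The functional on M/V is pushed into `k` along the prime field, so that its values can be
  -- weighted by powers of elements of `k`.
  let L (x : k) : k →+ k := (ZMod.castHom dvd_rfl k : ZMod p →+* k).toAddMonoidHom.comp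
    (lam.comp ((QuotientAddGroup.mk' V).comp
      (LinearMap.toSpanSingleton k M (h x - h 0)).toAddMonoidHom))
  have hL (x u : k) : L x u = ZMod.castHom dvd_rfl k (lam ((u • (h x - h 0) : M) : M ⧸ V)) := rfl
  have hL0 : L 0 = 0 := by
    ext u
    simp [hL]
  have := apply_eq_of_slope L hL0 (fun x y hxy => ?_) x u
  · rw [hL, hL] at this
    apply hlam
    have := (ZMod.castHom dvd_rfl k).injective this
    rw [← sub_eq_zero, ← map_sub, ← QuotientAddGroup.mk_sub] at this
    rw [← this]
    congr 2
    simp only [smul_sub, smul_add, smul_smul, mul_comm x u]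
    abel
  · rw [hL, hL, ← sub_eq_zero, ← map_sub, ← map_sub, ← QuotientAddGroup.mk_sub, ← smul_sub]
    obtain ⟨v, hv, e⟩ := hh y x
    have hyx : x - y ≠ 0 := sub_ne_zero.mpr hxy
    have e2 : (y - x)⁻¹ • (h x - h 0 - (h y - h 0)) = -v := by
      rw [sub_sub_sub_cancel_right, e, smul_smul, ← neg_sub x y, inv_neg, neg_mul,
        inv_mul_cancel₀ hyx, neg_one_smul]
    rw [e2, (QuotientAddGroup.eq_zero_iff (-v)).mpr (neg_mem hv), map_zero, map_zero]

end FiniteField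

/-! ### Additivity and multiplicativity from inverse identities -/

section Hua

variable {k : Type*} [Field k]

/-- Maps that preserve a pairing with values in `M ⧸ V` are additive. -/
theorem additive_of_smul_sub_smul_mem {M : Type*} [AddCommGroup M] [Nontrivial M] [Module k M]
    {V : AddSubgroup M} (hV : ∀ z : M, (∀ u : k, u • z ∈ V) → z = 0) {π : k → k} {G : M → M}
    (hπ : Function.Surjective π) (hG : Function.Surjective G)
    (h : ∀ u X, π u • G X - u • X ∈ V) :
    (∀ u u', π (u + u') = π u + π u') ∧ ∀ X X', G (X + X') = G X + G X' := by
  constructor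
  · intro u u'
    by_contra hne
    obtain ⟨m, hm⟩ := exists_ne (0 : M)
    refine hm (hV m fun c => ?_)
    obtain ⟨X, hX⟩ := hG ((π (u + u') - (π u + π u'))⁻¹ • c • m)
    have e : c • m = (π (u + u') - (π u + π u')) • G X := by
      rw [hX, smul_inv_smul₀ (sub_ne_zero.mpr hne)]
    rw [e]
    convert V.sub_mem (h (u + u') X) (V.add_mem (h u X) (h u' X)) using 1
    simp only [sub_smul, add_smul]
    abel
  · intro X X'
    rw [← sub_eq_zero]
    refine hV _ fun c => ?_
    obtain ⟨u, rfl⟩ := hπ c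
    convert V.sub_mem (h u (X + X')) (V.add_mem (h u X) (h u X')) using 1
    simp only [smul_sub, smul_add]
    abel

/-- Only the base points 0 and 1 are used: the first makes a ↦ f(a⁻¹)⁻¹ additive, and this rewrites
the identity at 1 as additivity of u ↦ 1 + f(u - 1). -/
theorem map_add_of_inv_sub_additive {f : k → k} (hf : Function.Injective f) (h0 : f 0 = 0)
    (h1 : f 1 = 1) (h : ∀ x u u', (f x - f (x - (u + u')⁻¹))⁻¹ =
      (f x - f (x - u⁻¹))⁻¹ + (f x - f (x - u'⁻¹))⁻¹) :
    (∀ a b, (f (a + b)⁻¹)⁻¹ = (f a⁻¹)⁻¹ + (f b⁻¹)⁻¹) ∧ ∀ a b, f (a + b) = f a + f b := by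
  have hf0 : ∀ {a}, a ≠ 0 → f a ≠ 0 := fun ha e => ha (hf (e.trans h0.symm))
  have hk : ∀ a b, (f (a + b)⁻¹)⁻¹ = (f a⁻¹)⁻¹ + (f b⁻¹)⁻¹ := by
    intro a b
    have := h 0 (-a) (-b)
    rw [← neg_add, h0] at this
    simp only [inv_neg, zero_sub, neg_neg] at this
    linear_combination -this
  refine ⟨hk, ?_⟩
  have key : ∀ u, (1 - f (1 - u⁻¹))⁻¹ = 1 + f (u - 1) := by
    intro u
    rcases eq_or_ne u 0 with rfl | hu
    · have := hk 1 (-1)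
      simp only [add_neg_cancel, inv_zero, h0, inv_one, h1, inv_neg] at this
      have h2 : (f (-1))⁻¹ = -1 := by linear_combination -this
      rw [inv_eq_iff_eq_inv] at h2
      simp [h1, h2]
    rcases eq_or_ne u 1 with rfl | hu1
    · simp [h0]
    have hs : u - 1 ≠ 0 := sub_ne_zero.mpr hu1
    have := hk 1 (u - 1)⁻¹
    have e : (1 + (u - 1)⁻¹)⁻¹ = 1 - u⁻¹ := by
      have : 1 + (u - 1)⁻¹ = u * (u - 1)⁻¹ := by field_simp; ring
      rw [this]
      field_simp
    rw [e, inv_one, h1, inv_one, inv_inv] at this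
    have hF := hf0 hs
    have hne : f (1 - u⁻¹) ≠ 0 := by
      apply hf0
      rw [← e]
      apply inv_ne_zero
      intro e'
      rw [e', inv_zero] at e
      have : u⁻¹ = 1 := by linear_combination e
      exact hu1 (inv_eq_one.mp this)
    have h2 : 1 - f (1 - u⁻¹) = f (1 - u⁻¹) * (f (u - 1))⁻¹ := by
      have h3 : f (1 - u⁻¹) * (f (1 - u⁻¹))⁻¹ = 1 := mul_inv_cancel₀ hne
      rw [this] at h3
      linear_combination -h3
    rw [h2, mul_inv, this, inv_inv]
    field_simp
    ring
  have hadd : ∀ u u', 1 + f (u + u' - 1) = (1 + f (u - 1)) + (1 + f (u' - 1)) := by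
    intro u u'
    have := h 1 u u'
    rwa [h1, key, key, key] at this
  intro a b
  have e3 := hadd (a + 1) (b + 1)
  have e5 := hadd (a + b + 1) 1
  simp only [add_sub_cancel_right, sub_self, h0] at e3 e5
  rw [show a + 1 + (b + 1) - 1 = a + b + 1 by ring] at e3
  linear_combination e3 - e5

/-- Hua's method: the identity ((ca)⁻¹ + (c(1 - a))⁻¹)⁻¹ = ca - ca² turns the two additivities into
a rule for squares. -/
theorem map_mul_of_inv_additive {f : k → k} (hf : Function.Injective f) (h0 : f 0 = 0)
    (h1 : f 1 = 1) (hk : ∀ a b, (f (a + b)⁻¹)⁻¹ = (f a⁻¹)⁻¹ + (f b⁻¹)⁻¹)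
    (hadd : ∀ a b, f (a + b) = f a + f b) (a b : k) : f (a * b) = f a * f b := by
  have hf0 : ∀ {a}, a ≠ 0 → f a ≠ 0 := fun ha e => ha (hf (e.trans h0.symm))
  have hsub : ∀ a b, f (a - b) = f a - f b := by
    intro a b
    have := hadd (a - b) b
    rw [sub_add_cancel] at this
    linear_combination -this
  have hsq : ∀ c a, f (c * a ^ 2) * f c = f (c * a) ^ 2 := by
    intro c a
    rcases eq_or_ne c 0 with rfl | hc
    · simp [h0]
    rcases eq_or_ne a 0 with rfl | ha
    · simp [h0]
    rcases eq_or_ne a 1 with rfl | ha1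
    · simp [sq]
    have h1a : 1 - a ≠ 0 := sub_ne_zero.mpr ha1.symm
    have e := hk (c * a)⁻¹ (c * (1 - a))⁻¹
    have e' : ((c * a)⁻¹ + (c * (1 - a))⁻¹)⁻¹ = c * a - c * a ^ 2 := by
      have : (c * a)⁻¹ + (c * (1 - a))⁻¹ = (c * a * (1 - a))⁻¹ := by
        field_simp
        ring
      rw [this, inv_inv]
      ring
    rw [e', inv_inv, inv_inv, hsub, show c * (1 - a) = c - c * a by ring, hsub] at e
    have n1 : f (c * a) ≠ 0 := hf0 (mul_ne_zero hc ha)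
    have n2 : f c - f (c * a) ≠ 0 := by
      rw [← hsub, show c - c * a = c * (1 - a) by ring]
      exact hf0 (mul_ne_zero hc h1a)
    have n3 : f (c * a) - f (c * a ^ 2) ≠ 0 := by
      rw [← hsub, show c * a - c * a ^ 2 = c * a * (1 - a) by ring]
      exact hf0 (mul_ne_zero (mul_ne_zero hc ha) h1a)
    field_simp at e
    linear_combination e
  have hsq1 : ∀ a, f (a ^ 2) = f a ^ 2 := fun a => by simpa [h1] using hsq 1 a
  -- In characteristic 2 polarization fails, so the weighted rule with c = b² is used and squaring
  -- is injective; otherwise (a + b)² is expanded.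
  rcases eq_or_ne (2 : k) 0 with h2 | h2
  · rcases eq_or_ne b 0 with rfl | hb
    · simp [h0]
    have := hsq (b ^ 2) (a * b⁻¹)
    rw [show b ^ 2 * (a * b⁻¹) ^ 2 = a ^ 2 by field_simp,
      show b ^ 2 * (a * b⁻¹) = a * b by field_simp, hsq1, hsq1, ← mul_pow] at this
    rcases sq_eq_sq_iff_eq_or_eq_neg.mp this with e | e
    · exact e.symm
    · linear_combination -e + f (a * b) * h2
  · have e := hsq1 (a + b)
    rw [show (a + b) ^ 2 = a ^ 2 + b ^ 2 + a * b + a * b by ring, hadd, hadd, hadd, hadd, hsq1,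
      hsq1] at e
    apply mul_left_cancel₀ h2
    linear_combination e

end Hua

namespace CycScheme

open IsLocalRing

/-! ### I₀ as a residue-field space, Teichmüller units and purity -/

section LocalRing

variable {R : Type*} [CommRing R] [IsLocalRing R]

theorem mem_idealI₀ {z : R} :
    z ∈ idealI₀ R ↔ z ∈ maximalIdeal R ∧ ∀ m ∈ maximalIdeal R, z * m = 0 := by
  simp [idealI₀, Submodule.mem_annihilator]

theorem mem_maximalIdeal_of_mul_mem_idealI₀ {z b : R} (h : z * b ∈ idealI₀ R)
    (hb : b ∉ idealI₀ R) : z ∈ maximalIdeal R := by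
  by_contra hz
  rw [notMem_maximalIdeal] at hz
  exact hb ((Ideal.unit_mul_mem_iff_mem _ hz).mp h)

noncomputable instance : Module (ResidueField R) (idealI₀ R) :=
  Module.IsTorsionBySet.module (R := R) (I := maximalIdeal R) (M := idealI₀ R) <| by
    rintro ⟨z, hz⟩ ⟨m, hm⟩
    ext
    simpa [mul_comm] using (mem_idealI₀.mp hz).2 m hm

theorem coe_residue_smul (r : R) (z : idealI₀ R) :
    ((residue R r • z : idealI₀ R) : R) = r * z := rfl

theorem idealI₀_mul_mem {z m : R} (hz : z ∈ idealI₀ R) (hm : m ∈ maximalIdeal R) : z * m = 0 :=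
  (mem_idealI₀.mp hz).2 m hm

theorem coe_mem_maximalIdeal (z : idealI₀ R) : (z : R) ∈ maximalIdeal R := (mem_idealI₀.mp z.2).1

theorem residue_coe (z : idealI₀ R) : residue R (z : R) = 0 :=
  (residue_eq_zero_iff _).mpr (coe_mem_maximalIdeal z)

theorem one_add_pow_of_mem_idealI₀ {v : R} (hv : v ∈ idealI₀ R) (n : ℕ) :
    (1 + v) ^ n = 1 + n * v := by
  have hvv : v * v = 0 := idealI₀_mul_mem hv (mem_idealI₀.mp hv).1
  induction n with
  | zero => simp
  | succ n ih =>
    rw [pow_succ, ih]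
    push_cast
    linear_combination n * hvv

/-- The additive group of all `v ∈ I₀` such that `1 + v` lies in `K` up to a Teichmüller unit. -/
def slopeGroup (K : Subgroup Rˣ) : AddSubgroup (idealI₀ R) where
  carrier := {v | ∃ t ∈ teichmuller R, ∃ k ∈ K, (k : R) = t * (1 + (v : R))}
  zero_mem' := ⟨1, one_mem _, 1, one_mem _, by simp⟩
  add_mem' := by
    rintro v w ⟨t, ht, k, hk, e⟩ ⟨t', ht', k', hk', e'⟩
    refine ⟨t * t', mul_mem ht ht', k * k', mul_mem hk hk', ?_⟩
    have := idealI₀_mul_mem v.2 (coe_mem_maximalIdeal w)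
    push_cast
    rw [e, e']
    linear_combination (t : R) * t' * this
  neg_mem' := by
    rintro v ⟨t, ht, k, hk, e⟩
    refine ⟨t⁻¹, inv_mem ht, k⁻¹, inv_mem hk, ?_⟩
    have hvv := idealI₀_mul_mem v.2 (coe_mem_maximalIdeal v)
    refine k.isUnit.mul_left_cancel ?_
    rw [Units.mul_inv, e]
    push_cast
    linear_combination (-1 + (v : R) * v) * t.mul_inv + hvv

theorem exists_mem_slopeGroup {K : Subgroup Rˣ} (hK : K ≤ teichmuller R ⊔ oneAdd (idealI₀ R))
    {k : Rˣ} (hk : k ∈ K) :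
    ∃ t ∈ teichmuller R, ∃ v ∈ slopeGroup K, (k : R) = t * (1 + (v : R)) := by
  obtain ⟨t, ht, u, hu, rfl⟩ := Subgroup.mem_sup.mp (hK hk)
  refine ⟨t, ht, ⟨u - 1, hu⟩, ⟨t, ht, _, hk, ?_⟩, ?_⟩ <;> simp

variable [Finite R]

instance : Finite (ResidueField R) := Finite.of_surjective _ residue_surjective

theorem card_residueField_mem : (Nat.card (ResidueField R) : R) ∈ maximalIdeal R := by
  rw [← residue_eq_zero_iff, map_natCast]
  have := Fintype.ofFinite (ResidueField R)
  rw [Nat.card_eq_fintype_card, Nat.cast_card_eq_zero]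

/-- In t^(q-1) - 1 = (t - 1)(1 + t + ⋯ + t^(q-2)) the second factor has residue q - 1 = -1, hence is
a unit. -/
theorem eq_one_of_mem_teichmuller {t : Rˣ} (ht : t ∈ teichmuller R)
    (h : residue R (t : R) = 1) : t = 1 := by
  set q := Nat.card (ResidueField R) with hq
  have hq1 : 1 ≤ q := Nat.card_pos
  have h1 : (t : R) ^ (q - 1) = 1 := by
    have : t ^ (q - 1) = 1 := ht
    rw [← Units.val_pow_eq_pow_val, this, Units.val_one]
  have h2 := geom_sum_mul (t : R) (q - 1)
  rw [h1, sub_self] at h2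
  have h3 : IsUnit (∑ i ∈ Finset.range (q - 1), (t : R) ^ i) := by
    rw [← residue_ne_zero_iff_isUnit]
    have h0 : ((q : ℕ) : ResidueField R) = 0 := by
      rw [← map_natCast (residue R), residue_eq_zero_iff]
      exact card_residueField_mem
    simp [h, Nat.cast_sub hq1, h0]
  have := (IsUnit.mul_right_eq_zero h3).mp h2
  ext
  simpa [sub_eq_zero] using this

theorem eq_of_mem_teichmuller {t t' : Rˣ} (ht : t ∈ teichmuller R) (ht' : t' ∈ teichmuller R)
    (h : residue R (t : R) = residue R (t' : R)) : t = t' := by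
  rw [← mul_inv_eq_one]
  refine eq_one_of_mem_teichmuller (mul_mem ht (inv_mem ht')) ?_
  rw [Units.val_mul, map_mul, h, ← map_mul, ← Units.val_mul, mul_inv_cancel, Units.val_one,
    map_one]

theorem IsPure.eq_zero {K : Subgroup Rˣ} (hK : IsPure K) (z : idealI₀ R)
    (hz : ∀ u : ResidueField R, u • z ∈ slopeGroup K) : z = 0 := by
  have key : ∀ r : R, ∃ k ∈ K, (k : R) = 1 + r * z := by
    intro r
    -- The (q-1)-st power removes t and turns 1 - rz into 1 - (q - 1)rz = 1 + rz, since qz = 0;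
    -- hence the sign.
    obtain ⟨t, ht, k, hk, e⟩ := hz (residue R (-r))
    rw [coe_residue_smul] at e
    refine ⟨k ^ (Nat.card (ResidueField R) - 1), pow_mem hk _, ?_⟩
    have ht' : t ^ (Nat.card (ResidueField R) - 1) = 1 := ht
    have hq : 1 ≤ Nat.card (ResidueField R) := Nat.card_pos
    rw [Units.val_pow_eq_pow_val, e, mul_pow, ← Units.val_pow_eq_pow_val, ht',
      one_add_pow_of_mem_idealI₀ (Ideal.mul_mem_left _ _ z.2), Nat.cast_sub hq]
    have := idealI₀_mul_mem z.2 (card_residueField_mem (R := R))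
    push_cast
    linear_combination (-r) * this
  have := hK (Ideal.span {(z : R)}) ?_
  · ext
    simpa using this
  · apply Set.Subset.antisymm
    · rintro _ ⟨_, ⟨k, hk, rfl⟩, w, hw, rfl⟩
      obtain ⟨r, rfl⟩ := Ideal.mem_span_singleton'.mp hw
      obtain ⟨l, hl, e⟩ := key (((k⁻¹ : Rˣ) : R) * r)
      refine ⟨k * l, mul_mem hk hl, ?_⟩
      push_cast
      rw [e]
      linear_combination r * z * k.mul_inv
    · rintro _ ⟨k, hk, rfl⟩
      exact ⟨k, ⟨k, hk, rfl⟩, 0, zero_mem _, by simp⟩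

/-- Here rad(R) = I₀ and u = u^q · (u^(q-1))⁻¹. The second factor is in 1 + I₀, and the first is
Teichmüller because (1 + v)^q = 1 + qv = 1 on 1 + I₀. -/
theorem teichmuller_sup_oneAdd_eq_top (h : maximalIdeal R ^ 2 = ⊥) :
    teichmuller R ⊔ oneAdd (idealI₀ R) = ⊤ := by
  have hI {z : R} (hz : z ∈ maximalIdeal R) : z ∈ idealI₀ R := by
    refine mem_idealI₀.mpr ⟨hz, fun m hm => ?_⟩
    have := Ideal.mul_mem_mul hz hm
    rwa [← sq, h] at this
  rw [eq_top_iff]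
  intro u _
  set q := Nat.card (ResidueField R) with hq
  have hq1 : 1 ≤ q := Nat.card_pos
  have h1 : ((u ^ (q - 1) : Rˣ) : R) - 1 ∈ maximalIdeal R := by
    have hu : residue R (u : R) ≠ 0 := (residue_ne_zero_iff_isUnit _).mpr u.isUnit
    have := Fintype.ofFinite (ResidueField R)
    rw [← residue_eq_zero_iff, map_sub, Units.val_pow_eq_pow_val, map_pow, hq,
      Nat.card_eq_fintype_card, FiniteField.pow_card_sub_one_eq_one _ hu, map_one, sub_self]
  have h2 : u ^ q ∈ teichmuller R := by
    change (u ^ q) ^ (q - 1) = 1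
    rw [pow_right_comm]
    ext
    have e := one_add_pow_of_mem_idealI₀ (hI h1) q
    rw [add_sub_cancel, mul_comm, idealI₀_mul_mem (hI h1) card_residueField_mem, add_zero] at e
    rw [Units.val_pow_eq_pow_val, e, Units.val_one]
  have e : u = u ^ q * (u ^ (q - 1))⁻¹ := by
    rw [eq_mul_inv_iff_mul_eq, ← pow_succ', Nat.sub_add_cancel hq1]
  rw [e]
  exact mul_mem (Subgroup.mem_sup_left h2) (Subgroup.mem_sup_right (inv_mem (hI h1)))

variable {V : AddSubgroup (idealI₀ R)}

theorem eq_add_smul_of_twisted_slope_mem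
    (hV : ∀ z : idealI₀ R, (∀ u : ResidueField R, u • z ∈ V) → z = 0)
    (σ : ResidueField R ≃+* ResidueField R) (φ : R → idealI₀ R)
    (h : ∀ x y, ∃ v ∈ V, φ y - φ x = σ (residue R (y - x)) • v) (x : R) :
    φ x = φ 0 + σ (residue R x) • (φ 1 - φ 0) := by
  -- A zero residue difference kills the slope term, so φ descends to the residue field;
  -- precomposing with σ⁻¹ removes the twist.
  have hφ : ∀ x y, residue R x = residue R y → φ y = φ x := by
    intro x y e
    obtain ⟨v, -, e'⟩ := h x y
    rw [map_sub, e, sub_self, map_zero, zero_smul] at e'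
    exact sub_eq_zero.mp e'
  set s := Function.surjInv (residue_surjective (R := R))
  have hs : ∀ a, residue R (s a) = a := Function.surjInv_eq _
  have hφ' : ∀ x, φ (s (σ.symm (σ (residue R x)))) = φ x := fun x => hφ _ _ (by simp [hs])
  have := eq_add_smul_of_slope_mem hV (fun a => φ (s (σ.symm a))) (fun a b => by
    simpa [hs] using h (s (σ.symm a)) (s (σ.symm b))) (σ (residue R x))
  have e0 := hφ' 0
  have e1 := hφ' 1
  simp only [map_zero, map_one] at e0 e1
  simpa only [hφ', map_zero, map_one, e0, e1] using this

end LocalRing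

/-! ### Rigidity when the radical is not contained in I₀ -/

section Rigidity

variable {R : Type*} [CommRing R] [IsLocalRing R]

/-- Differences are preserved up to Teichmüller units and units `1 + v`, `v ∈ V`. -/
def PreservesDifferences (V : AddSubgroup (idealI₀ R)) (f : R → R) : Prop :=
  ∀ x y, ∃ t ∈ teichmuller R, ∃ v ∈ V, f x - f y = t * (1 + (v : R)) * (x - y)

variable {V : AddSubgroup (idealI₀ R)} {f : R → R}

theorem PreservesDifferences.exists_sub_mem (hf : PreservesDifferences V f) (x y : R) :
    ∃ t ∈ teichmuller R, f x - f y - (t : R) * (x - y) ∈ idealI₀ R := by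
  obtain ⟨t, ht, v, -, e⟩ := hf x y
  refine ⟨t, ht, ?_⟩
  have : f x - f y - (t : R) * (x - y) = t * (x - y) * v := by rw [e]; ring
  rw [this]
  exact Ideal.mul_mem_left _ _ v.2

variable [Finite R]

/-- Closing the triangle with t₃ for the pair x, z gives (t₁ - t₃)(x - y) + (t₂ - t₃)(y - z) ∈ I₀.
Modulo the radical t₁ = t₃; then t₂ - t₃ is not a unit because y - z ∉ I₀. -/
theorem PreservesDifferences.eq_of_isUnit (hf : PreservesDifferences V f) {x y z : R}
    (hxy : IsUnit (x - y)) (hyz : y - z ∈ maximalIdeal R) (hyz' : y - z ∉ idealI₀ R)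
    {t₁ t₂ : Rˣ} (ht₁ : t₁ ∈ teichmuller R) (ht₂ : t₂ ∈ teichmuller R)
    (h₁ : f x - f y - (t₁ : R) * (x - y) ∈ idealI₀ R)
    (h₂ : f y - f z - (t₂ : R) * (y - z) ∈ idealI₀ R) : t₁ = t₂ := by
  obtain ⟨t₃, ht₃, h₃⟩ := hf.exists_sub_mem x z
  have h : ((t₁ : R) - t₃) * (x - y) + ((t₂ : R) - t₃) * (y - z) ∈ idealI₀ R := by
    convert sub_mem h₃ (add_mem h₁ h₂) using 1
    ring
  have e₁₃ : t₁ = t₃ := by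
    refine eq_of_mem_teichmuller ht₁ ht₃ (sub_eq_zero.mp ?_)
    rw [← map_sub, residue_eq_zero_iff]
    have := sub_mem (mem_idealI₀.mp h).1 (Ideal.mul_mem_left _ ((t₂ : R) - t₃) hyz)
    rw [add_sub_cancel_right] at this
    exact (Ideal.mul_unit_mem_iff_mem _ hxy).mp this
  rw [e₁₃, sub_self, zero_mul, zero_add] at h
  rw [e₁₃]
  refine (eq_of_mem_teichmuller ht₂ ht₃ (sub_eq_zero.mp ?_)).symm
  rw [← map_sub, residue_eq_zero_iff]
  exact mem_maximalIdeal_of_mul_mem_idealI₀ h hyz'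

/-- By `eq_of_isUnit` the factor 1 of the pair 1, 0 passes to radical elements outside I₀, and from
b back to every unit. -/
theorem PreservesDifferences.sub_self_mem (hf : PreservesDifferences V f) (h0 : f 0 = 0)
    (h1 : f 1 = 1) {b : R} (hb : b ∈ maximalIdeal R) (hb' : b ∉ idealI₀ R) (x : R) :
    f x - x ∈ idealI₀ R := by
  have key : ∀ z ∈ maximalIdeal R, z ∉ idealI₀ R → f z - z ∈ idealI₀ R := by
    intro z hz hz'
    obtain ⟨t, ht, h⟩ := hf.exists_sub_mem 0 z
    have := hf.eq_of_isUnit (x := 1) (y := 0) (z := z) (by simp) (by simpa using hz)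
      (by simpa using hz') (one_mem _) ht (by simp [h0, h1]) h
    rw [← this, h0] at h
    convert neg_mem h using 1
    push_cast
    ring
  by_cases hx : x ∈ maximalIdeal R
  · by_cases hx' : x ∈ idealI₀ R
    · obtain ⟨t, -, v, -, e⟩ := hf x 0
      rw [h0, sub_zero, sub_zero] at e
      rw [e]
      exact sub_mem (Ideal.mul_mem_left _ _ hx') hx'
    · exact key x hx hx'
  · rw [notMem_maximalIdeal] at hx
    obtain ⟨t, ht, h⟩ := hf.exists_sub_mem x 0
    have hb1 := key b hb hb'
    have := hf.eq_of_isUnit (x := x) (y := 0) (z := b) (by simpa using hx) (by simpa using hb)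
      (by simpa using hb') ht (one_mem _) h (by
        convert neg_mem hb1 using 1
        rw [h0]
        push_cast
        ring)
    simpa [this, h0] using h

theorem PreservesDifferences.eq_self_of_lt
    (hV : ∀ z : idealI₀ R, (∀ u : ResidueField R, u • z ∈ V) → z = 0)
    (hf : PreservesDifferences V f) (h0 : f 0 = 0) (h1 : f 1 = 1)
    {b : R} (hb : b ∈ maximalIdeal R) (hb' : b ∉ idealI₀ R) (x : R) : f x = x := by
  have hmem := hf.sub_self_mem h0 h1 hb hb'
  have step : ∀ x y, x - y ∉ idealI₀ R → ∃ v ∈ V, f x - f y = (1 + (v : R)) * (x - y) := by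
    intro x y hxy
    obtain ⟨t, ht, v, hv, e⟩ := hf x y
    refine ⟨v, hv, ?_⟩
    have : t = 1 := by
      refine eq_one_of_mem_teichmuller ht (sub_eq_zero.mp ?_)
      rw [← map_one (residue R), ← map_sub, residue_eq_zero_iff]
      refine mem_maximalIdeal_of_mul_mem_idealI₀ (b := x - y) ?_ hxy
      have h2 := sub_mem (sub_mem (hmem x) (hmem y)) (Ideal.mul_mem_left _ ((t : R) * (x - y)) v.2)
      convert h2 using 1
      linear_combination -e
    rw [e, this]
    simp
  have const' : ∀ x y, x - y ∈ maximalIdeal R → x - y ∉ idealI₀ R → f x - x = f y - y := by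
    intro x y h h'
    obtain ⟨v, -, e⟩ := step x y h'
    have := idealI₀_mul_mem v.2 h
    linear_combination e + this
  have const : ∀ x y, x - y ∈ maximalIdeal R → f x - x = f y - y := by
    intro x y h
    by_cases h' : x - y ∈ idealI₀ R
    · rw [const' x (y + b) ?_ ?_, const' (y + b) y (by simpa using hb) (by simpa using hb')]
      · rw [← sub_sub]
        exact sub_mem h hb
      · rw [← sub_sub]
        exact fun h'' => hb' (by simpa using sub_mem h' h'')
    · exact const' x y h h'
  have := eq_add_smul_of_twisted_slope_mem hV (RingEquiv.refl _) (fun x => ⟨f x - x, hmem x⟩)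
    (fun x y => by
      by_cases h : y - x ∈ maximalIdeal R
      · refine ⟨0, zero_mem _, ?_⟩
        rw [smul_zero, sub_eq_zero]
        ext
        exact const y x h
      · obtain ⟨v, hv, e⟩ := step y x fun h' => h (mem_idealI₀.mp h').1
        refine ⟨v, hv, ?_⟩
        ext
        rw [RingEquiv.refl_apply, coe_residue_smul]
        push_cast
        linear_combination e) x
  simpa [h0, h1, Subtype.ext_iff, sub_eq_zero] using this

end Rigidity

/-! ### The case where the radical equals I₀ -/

section SquareZero

variable {R : Type*} [CommRing R] [IsLocalRing R] [Finite R]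
  {V : AddSubgroup (idealI₀ R)} {f : R → R}

/-- If the radical is `I₀`, then a difference preserving injection induces a field automorphism `σ`
of the residue field and acts on every coset of the radical by one `σ`-semilinear map. -/
theorem PreservesDifferences.exists_residueEquiv
    (hV : ∀ z : idealI₀ R, (∀ u : ResidueField R, u • z ∈ V) → z = 0)
    (hR : maximalIdeal R ≠ ⊥) (hn : maximalIdeal R ≤ idealI₀ R)
    (hf : PreservesDifferences V f) (hinj : Function.Injective f) (h0 : f 0 = 0) (h1 : f 1 = 1) :
    ∃ σ : ResidueField R ≃+* ResidueField R, (∀ x, residue R (f x) = σ (residue R x)) ∧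
      ∃ G : idealI₀ R → idealI₀ R, (∀ (x : R) (X : idealI₀ R), f (x + X) = f x + G X) ∧
        ∀ c X, G (c • X) = σ c • G X := by
  have hnt : Nontrivial (idealI₀ R) := by
    obtain ⟨z, hz, hz0⟩ := Submodule.exists_mem_ne_zero_of_ne_bot hR
    exact ⟨⟨⟨z, hn hz⟩, 0, by simpa [Subtype.ext_iff] using hz0⟩⟩
  have hres : ∀ x y, ∃ t ∈ teichmuller R, ∃ v ∈ V, f x - f y = t * (1 + (v : R)) * (x - y) ∧
      residue R (f x) - residue R (f y) =
        residue R (t : R) * (residue R x - residue R y) := by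
    intro x y
    obtain ⟨t, ht, v, hv, e⟩ := hf x y
    refine ⟨t, ht, v, hv, e, ?_⟩
    rw [← map_sub, e]
    simp [residue_coe]
  set s := Function.surjInv (residue_surjective (R := R))
  have hs : ∀ a, residue R (s a) = a := Function.surjInv_eq _
  set f₀ : ResidueField R → ResidueField R := fun a => residue R (f (s a)) with hf₀
  have hf₀r : ∀ x, residue R (f x) = f₀ (residue R x) := by
    intro x
    obtain ⟨t, -, v, -, -, e⟩ := hres x (s (residue R x))
    rw [hs, sub_self, mul_zero] at e
    exact sub_eq_zero.mp e
  have hunit : ∀ t : Rˣ, residue R (t : R) ≠ 0 := fun t =>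
    (residue_ne_zero_iff_isUnit _).mpr t.isUnit
  have hf₀inj : Function.Injective f₀ := by
    intro a b h
    obtain ⟨t, -, v, -, -, e⟩ := hres (s a) (s b)
    rw [hs, hs, hf₀r, hf₀r, hs, hs, h, sub_self] at e
    simpa [hunit, sub_eq_zero] using e.symm
  have hf₀surj : Function.Surjective f₀ := Finite.surjective_of_injective hf₀inj
  have hf₀0 : f₀ 0 = 0 := by
    have := hf₀r 0
    rwa [h0, map_zero, eq_comm] at this
  have hf₀1 : f₀ 1 = 1 := by
    have := hf₀r 1
    rwa [h1, map_one, eq_comm] at this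
  have hGmem : ∀ (x : R) (X : idealI₀ R), f (x + X) - f x ∈ idealI₀ R := by
    intro x X
    obtain ⟨t, -, v, -, e⟩ := hf (x + X) x
    rw [e, add_sub_cancel_left]
    exact Ideal.mul_mem_left _ _ X.2
  set G : R → idealI₀ R → idealI₀ R := fun x X => ⟨f (x + X) - f x, hGmem x X⟩ with hG
  have hGinj : ∀ x, Function.Injective (G x) := by
    intro x X X' h
    have : f (x + X) - f x = f (x + X') - f x := congrArg Subtype.val h
    ext
    exact add_left_cancel (hinj (sub_left_injective this))
  have hGsurj : ∀ x, Function.Surjective (G x) := fun x =>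
    Finite.surjective_of_injective (hGinj x)
  -- This comes from comparing x and x + X with one lift of a: both differences have the same
  -- residue, hence the same Teichmüller factor, and only v' - v remains. For equal residues both
  -- inverses are 0 by convention.
  have hpair : ∀ (x : R) (a : ResidueField R) (X : idealI₀ R),
      (f₀ (residue R x) - f₀ a)⁻¹ • G x X - (residue R x - a)⁻¹ • X ∈ V := by
    intro x a X
    rcases eq_or_ne (residue R x) a with rfl | hne
    · simp
    obtain ⟨t, ht, v, hv, e, er⟩ := hres x (s a)
    obtain ⟨t', ht', v', hv', e', er'⟩ := hres (x + X) (s a)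
    rw [map_add, residue_coe, add_zero, hf₀r, map_add, residue_coe, add_zero] at er'
    rw [hf₀r] at er
    have hd : residue R x - residue R (s a) ≠ 0 := by
      rw [hs]
      exact sub_ne_zero.mpr hne
    have htt : t' = t := eq_of_mem_teichmuller ht' ht (mul_right_cancel₀ hd (er'.symm.trans er))
    subst htt
    have hGX : G x X = residue R (t' : R) • X + residue R ((t' : R) * (x - s a)) • (v' - v) := by
      ext
      have := idealI₀_mul_mem v'.2 (coe_mem_maximalIdeal X)
      push_cast
      rw [coe_residue_smul, coe_residue_smul]
      push_cast
      linear_combination e' - e + (t' : R) * this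
    rw [hf₀r, hs] at er
    rw [hs] at hd
    rw [hGX, er, smul_add, smul_smul, smul_smul, map_mul, map_sub, hs, mul_inv]
    have ht0 := hunit t'
    rw [show (residue R (t' : R))⁻¹ * (residue R x - a)⁻¹ * residue R (t' : R) =
      (residue R x - a)⁻¹ by field_simp, ← mul_inv,
      inv_mul_cancel₀ (mul_ne_zero ht0 hd), one_smul, add_sub_cancel_left]
    exact sub_mem hv' hv
  have hpair' : ∀ (x : R) (u : ResidueField R) (X : idealI₀ R),
      (f₀ (residue R x) - f₀ (residue R x - u⁻¹))⁻¹ • G x X - u • X ∈ V := by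
    intro x u X
    simpa using hpair x (residue R x - u⁻¹) X
  have hπ : ∀ a, Function.Surjective fun u => (f₀ a - f₀ (a - u⁻¹))⁻¹ := by
    intro a w
    obtain ⟨b, hb⟩ := hf₀surj (f₀ a - w⁻¹)
    refine ⟨(a - b)⁻¹, ?_⟩
    simp [hb]
  have hadd := fun x => additive_of_smul_sub_smul_mem hV (hπ (residue R x)) (hGsurj x) (hpair' x)
  obtain ⟨hk, hfadd⟩ := map_add_of_inv_sub_additive hf₀inj hf₀0 hf₀1 fun a => by
    simpa [hs] using (hadd (s a)).1
  have hfmul := map_mul_of_inv_additive hf₀inj hf₀0 hf₀1 hk hfadd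
  let σ' : ResidueField R →+* ResidueField R :=
    { toFun := f₀, map_one' := hf₀1, map_mul' := hfmul, map_zero' := hf₀0, map_add' := hfadd }
  set σ : ResidueField R ≃+* ResidueField R :=
    RingEquiv.ofBijective σ' ⟨hf₀inj, hf₀surj⟩ with hσ
  have hσf : ∀ a, f₀ a = σ a := fun a => rfl
  have hpairσ : ∀ (x : R) (u : ResidueField R) (X : idealI₀ R), σ u • G x X - u • X ∈ V := by
    intro x u X
    have := hpair' x u X
    rwa [hσf, hσf, ← map_sub, sub_sub_cancel, ← map_inv₀, inv_inv] at this
  -- Once σ is additive, the pairing determines G modulo V independently of x, and the absence of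
  -- lines makes it exact.
  have hGx : ∀ x X, G x X = G 0 X := by
    intro x X
    rw [← sub_eq_zero]
    refine hV _ fun u => ?_
    obtain ⟨u, rfl⟩ := σ.surjective u
    convert sub_mem (hpairσ x u X) (hpairσ 0 u X) using 1
    rw [smul_sub]
    abel
  refine ⟨σ, hf₀r, G 0, fun x X => ?_, fun c X => ?_⟩
  · rw [← hGx x X]
    simp [hG]
  · rw [← sub_eq_zero]
    refine hV _ fun u => ?_
    obtain ⟨u, rfl⟩ := σ.surjective u
    convert sub_mem (hpairσ 0 u (c • X)) (hpairσ 0 (u * c) X) using 1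
    rw [smul_sub, map_mul, smul_smul, smul_smul]
    abel

theorem PreservesDifferences.map_add_map_mul
    (hV : ∀ z : idealI₀ R, (∀ u : ResidueField R, u • z ∈ V) → z = 0)
    (hR : maximalIdeal R ≠ ⊥) (hn : maximalIdeal R ≤ idealI₀ R)
    (hf : PreservesDifferences V f) (hinj : Function.Injective f) (h0 : f 0 = 0) (h1 : f 1 = 1) :
    (∀ x y, f (x + y) = f x + f y) ∧ ∀ x y, f (x * y) = f x * f y := by
  obtain ⟨σ, hσ, G, hG, hGsmul⟩ := hf.exists_residueEquiv hV hR hn hinj h0 h1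
  have hmax : ∀ z ∈ maximalIdeal R, ∃ Z : idealI₀ R, (Z : R) = z := fun z hz => ⟨⟨z, hn hz⟩, rfl⟩
  have hunit : ∀ {x y t : R} {v : idealI₀ R}, f x - f y = t * (1 + (v : R)) * (x - y) →
      σ (residue R (x - y)) = residue R (t * (x - y)) := by
    intro x y t v e
    have := congrArg (residue R) e
    simpa [hσ, residue_coe] using this
  have hteich : ∀ {t t' z : R}, residue R (t * z) = residue R (t' * z) → IsUnit z →
      residue R t = residue R t' := by
    intro t t' z e hz
    rw [map_mul, map_mul] at e
    exact mul_right_cancel₀ ((residue_ne_zero_iff_isUnit _).mpr hz) e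
  have hdiff : ∀ x y z, ∃ v ∈ V, f (x + z) - f x - (f (y + z) - f y) =
      ((σ (residue R z) • v : idealI₀ R) : R) := by
    intro x y z
    by_cases hz : z ∈ maximalIdeal R
    · obtain ⟨Z, rfl⟩ := hmax z hz
      refine ⟨0, zero_mem _, ?_⟩
      rw [hG, hG, smul_zero]
      simp
    · rw [notMem_maximalIdeal] at hz
      obtain ⟨t, ht, v, hv, e⟩ := hf (x + z) x
      obtain ⟨t', ht', v', hv', e'⟩ := hf (y + z) y
      have er := hunit e
      have er' := hunit e'
      rw [add_sub_cancel_left] at e e' er er'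
      obtain rfl := eq_of_mem_teichmuller ht ht' (hteich (er.symm.trans er') hz)
      refine ⟨v - v', sub_mem hv hv', ?_⟩
      rw [er, coe_residue_smul, e, e']
      push_cast
      ring
  have hmem : ∀ x y, f (x + y) - f x - f y ∈ idealI₀ R := by
    intro x y
    obtain ⟨v, -, e⟩ := hdiff x 0 y
    rw [zero_add, h0, sub_zero] at e
    rw [e]
    exact SetLike.coe_mem _
  set E : R → R → idealI₀ R := fun x y => ⟨f (x + y) - f x - f y, hmem x y⟩ with hE
  have hEV : ∀ x y, ∃ v ∈ V, E x y = σ (residue R y) • v := by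
    intro x y
    obtain ⟨v, hv, e⟩ := hdiff x 0 y
    rw [zero_add, h0, sub_zero] at e
    exact ⟨v, hv, Subtype.ext e⟩
  have hE1 : ∀ x y, E x y = σ (residue R y) • E x 1 := by
    intro x y
    have := eq_add_smul_of_twisted_slope_mem hV σ (E x) (fun y y' => by
      obtain ⟨v, hv, e⟩ := hdiff (x + y) y (y' - y)
      refine ⟨v, hv, Subtype.ext ?_⟩
      rw [← e]
      push_cast
      rw [add_assoc, add_sub_cancel]
      ring) y
    have e0 : E x 0 = 0 := by
      ext
      simp [hE, h0]
    rwa [e0, zero_add, sub_zero] at this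
  have hEsymm : ∀ x y, E x y = E y x := by
    intro x y
    ext
    simp only [hE]
    rw [add_comm x y]
    ring
  -- By symmetry σ(u)E(1,1) equals some E(x,1), which lies in V since σ(1) = 1; so the line through
  -- E(1,1) lies in V.
  have hE11 : E 1 1 = 0 := by
    refine hV _ fun u => ?_
    obtain ⟨u, rfl⟩ := σ.surjective u
    obtain ⟨x, rfl⟩ := residue_surjective u
    rw [← hE1, hEsymm]
    obtain ⟨v, hv, e⟩ := hEV x 1
    rw [e, map_one, map_one, one_smul]
    exact hv
  have hadd : ∀ x y, f (x + y) = f x + f y := by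
    intro x y
    have : E x y = 0 := by
      rw [hE1, hEsymm, hE1, hE11, smul_zero, smul_zero]
    have : f (x + y) - f x - f y = 0 := congrArg Subtype.val this
    linear_combination this
  refine ⟨hadd, ?_⟩
  have hfcoe : ∀ Z : idealI₀ R, f Z = G Z := by
    intro Z
    have := hG 0 Z
    rwa [zero_add, h0, zero_add] at this
  have hmulcoe : ∀ x (Z : idealI₀ R), f (x * Z) = f x * f Z := by
    intro x Z
    have := hGsmul (residue R x) Z
    rw [← hσ] at this
    rw [hfcoe, ← coe_residue_smul, ← coe_residue_smul, ← this, hfcoe]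
  have hmulV : ∀ x y, ∃ v ∈ V, f (x * y) - f x * f y =
      ((σ (residue R x) • σ (residue R y) • v : idealI₀ R) : R) := by
    intro x y
    by_cases hy : y ∈ maximalIdeal R
    · obtain ⟨Z, rfl⟩ := hmax y hy
      exact ⟨0, zero_mem _, by simp [hmulcoe]⟩
    by_cases hx : x ∈ maximalIdeal R
    · obtain ⟨Z, rfl⟩ := hmax x hx
      refine ⟨0, zero_mem _, ?_⟩
      rw [mul_comm, hmulcoe]
      simp [mul_comm]
    rw [notMem_maximalIdeal] at hx hy
    obtain ⟨t, ht, v, hv, e⟩ := hf x 0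
    obtain ⟨t', ht', v', hv', e'⟩ := hf y 0
    obtain ⟨t'', ht'', v'', hv'', e''⟩ := hf (x * y) 0
    have er := hunit e
    have er' := hunit e'
    have er'' := hunit e''
    simp only [h0, sub_zero] at e e' e'' er er' er''
    have htt : t'' = t * t' := by
      refine eq_of_mem_teichmuller ht'' (mul_mem ht ht') (hteich (z := x * y) ?_ (hx.mul hy))
      rw [← er'', map_mul, map_mul, er, er', ← map_mul]
      push_cast
      congr 1
      ring
    refine ⟨v'' - v - v', sub_mem (sub_mem hv'' hv) hv', ?_⟩
    have hvv := idealI₀_mul_mem v.2 (coe_mem_maximalIdeal v')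
    rw [er, er', coe_residue_smul, coe_residue_smul, e, e', e'', htt]
    push_cast
    linear_combination (-(t : R) * t' * x * y) * hvv
  intro x y
  by_cases hx : x ∈ maximalIdeal R
  · obtain ⟨Z, rfl⟩ := hmax x hx
    rw [mul_comm, hmulcoe, mul_comm]
  have hx0 : σ (residue R x) ≠ 0 := by
    rw [Ne, map_eq_zero_iff _ σ.injective, residue_eq_zero_iff]
    exact hx
  have hmulmem : ∀ y, f (x * y) - f x * f y ∈ idealI₀ R := by
    intro y
    obtain ⟨v, -, e⟩ := hmulV x y
    rw [e]
    exact SetLike.coe_mem _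
  set M : R → idealI₀ R := fun y => ⟨f (x * y) - f x * f y, hmulmem y⟩ with hM
  have hM0 : M 0 = 0 := by
    ext
    simp [hM, h0]
  have hM1 : M 1 = 0 := by
    ext
    simp [hM, h1]
  -- Dividing by σ(x) strips one factor from `hmulV`, leaving twisted slopes in V; additivity of f
  -- turns increments of M into values of M.
  have := eq_add_smul_of_twisted_slope_mem hV σ (fun y => (σ (residue R x))⁻¹ • M y)
    (fun y y' => by
      obtain ⟨v, hv, e⟩ := hmulV x (y' - y)
      refine ⟨v, hv, ?_⟩
      rw [← smul_sub, inv_smul_eq_iff₀ hx0]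
      ext
      rw [← e]
      have e1 := hadd (x * y) (x * (y' - y))
      have e2 := hadd y (y' - y)
      rw [← mul_add, add_sub_cancel] at e1
      rw [add_sub_cancel] at e2
      push_cast
      linear_combination e1 - f x * e2) y
  simp only [hM0, hM1, smul_zero, sub_zero, add_zero, smul_eq_zero, inv_eq_zero, hx0,
    false_or] at this
  exact sub_eq_zero.mp (congrArg Subtype.val this)

end SquareZero

/-! ### Normality of the cyclotomic scheme -/

theorem cyc_isNormal {R : Type*} [CommRing R] [Finite R] [IsLocalRing R] (hR : ¬ IsField R)
    {K : Subgroup Rˣ} (hK : IsPure K) (hKT : K ≤ teichmuller R ⊔ oneAdd (idealI₀ R)) :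
    (cyc K).IsNormal := by
  intro f hf
  have hdiff : ∀ x y, ∃ k ∈ K, f y - f x = (y - x) * (k : R) := by
    intro x y
    have h := hf (cycRel K (y - x)) ⟨_, rfl⟩
    have hmem : Prod.map f f (x, y) ∈ cycRel K (y - x) := by
      rw [← h]
      exact Set.mem_image_of_mem _ ⟨1, one_mem _, by simp⟩
    exact hmem
  obtain ⟨a, ha, e⟩ := hdiff 0 1
  rw [sub_zero, one_mul] at e
  set g : R → R := fun x => ((a⁻¹ : Rˣ) : R) * (f x - f 0) with hg
  have hg0 : g 0 = 0 := by simp [hg]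
  have hg1 : g 1 = 1 := by simp [hg, e]
  have hginj : Function.Injective g := by
    intro x y h
    exact f.injective (sub_left_injective ((a⁻¹).isUnit.mul_left_cancel h))
  have hgV : PreservesDifferences (slopeGroup K) g := by
    intro x y
    obtain ⟨k, hk, e⟩ := hdiff y x
    obtain ⟨t, ht, v, hv, e'⟩ := exists_mem_slopeGroup hKT (mul_mem (inv_mem ha) hk)
    refine ⟨t, ht, v, hv, ?_⟩
    rw [← e']
    simp only [hg]
    push_cast
    linear_combination ((a⁻¹ : Rˣ) : R) * e
  have hmax : IsLocalRing.maximalIdeal R ≠ ⊥ := fun h => hR (isField_iff_maximalIdeal_eq.mpr h)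
  have hring : (∀ x y, g (x + y) = g x + g y) ∧ ∀ x y, g (x * y) = g x * g y := by
    by_cases hn : IsLocalRing.maximalIdeal R ≤ idealI₀ R
    · exact hgV.map_add_map_mul hK.eq_zero hmax hn hginj hg0 hg1
    · obtain ⟨b, hb, hb'⟩ := SetLike.not_le_iff_exists.mp hn
      simp [hgV.eq_self_of_lt hK.eq_zero hg0 hg1 hb hb']
  let σ' : R →+* R :=
    { toFun := g, map_one' := hg1, map_mul' := hring.2, map_zero' := hg0, map_add' := hring.1 }
  refine ⟨a, RingEquiv.ofBijective σ' ⟨hginj, Finite.surjective_of_injective hginj⟩, f 0,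
    fun x => ?_⟩
  change f x = a * (((a⁻¹ : Rˣ) : R) * (f x - f 0)) + f 0
  rw [Units.mul_inv_cancel_left, sub_add_cancel]

end CycScheme

theorem mainTheorem6 {R : Type*} [CommRing R] [Finite R] [IsLocalRing R] (hR : ¬ IsField R) :
    (∀ K : Subgroup Rˣ, CycScheme.IsPure K →
      K ≤ CycScheme.teichmuller R ⊔ CycScheme.oneAdd (CycScheme.idealI₀ R) →
      (CycScheme.cyc K).IsNormal) ∧
    (IsLocalRing.maximalIdeal R ^ 2 = ⊥ →
      ∀ K : Subgroup Rˣ, CycScheme.IsPure K → (CycScheme.cyc K).IsNormal) :=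
  ⟨fun _ hK hKT => CycScheme.cyc_isNormal hR hK hKT, fun h _ hK =>
    CycScheme.cyc_isNormal hR hK (CycScheme.teichmuller_sup_oneAdd_eq_top h ▸ le_top)⟩
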